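/- For an integer $q\ge 1$ let $e_0,\dots,e_q$ be the standard basis of $\mathbb{C}^{q+1}$ and let \[ T_{cw,q}=\sum_{j=1}^{q}\bigl(e_0\otimes e_j\otimes e_j+e_j\otimes e_0\otimes e_j+e_j\otimes e_j\otimes e_0\bigr)\in(\mathbb{C}^{q+1})^{\otimes 3} \] be the little Coppersmith–Winograd tensor. For finite-dimensional complex vector spaces $A,B,C$ and $T\in A\otimes B\otimes C$, the rank $\mathbf{R}(T)$ is the least $r$ such that $T$ is a sum of $r$ simple tensors $x\otimes y\otimes z$, and the border rank $\underline{\mathbf R}(T)$ is the least $r$ such that $T$ is the limit, in the Euclidean topology, of a sequence of tensors of rank at most $r$. The Kronecker product of $T\in A\otimes B\otimes C$ and $S\in A'\otimes B'\otimes C'$ is the tensor $T\boxtimes S\in (A\otimes A')\otimes(B\otimes B')\otimes(C\otimes C')$ obtained by bilinear extension from \[ (a\otimes b\otimes c)\boxtimes(a'\otimes b'\otimes c')=(a\otimes a')\otimes(b\otimes b')\otimes(c\otimes c'), \] and $T^{\boxtimes 2}=T\boxtimes T$. **Theorem.** For every integer $q\ge 3$, \[ \underline{\mathbf R}\bigl(T_{cw,q}^{\boxtimes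 2}\bigr)=(q+2)^2 . \] -/

import Mathlib

open scoped TensorProduct

namespace BorderRank

section General

variable {A B C A' B' C' : Type*}
  [AddCommGroup A] [Module ℂ A] [AddCommGroup B] [Module ℂ B] [AddCommGroup C] [Module ℂ C]
  [AddCommGroup A'] [Module ℂ A'] [AddCommGroup B'] [Module ℂ B'] [AddCommGroup C'] [Module ℂ C']

/-- `T` is a sum of `r` simple tensors `x ⊗ y ⊗ z` (some of which may vanish). -/
def IsSumOfSimple (T : A ⊗[ℂ] B ⊗[ℂ] C) (r : ℕ) : Prop :=
  ∃ (x : Fin r → A) (y : Fin r → B) (z : Fin r → C), T = ∑ l, x l ⊗ₜ[ℂ] y l ⊗ₜ[ℂ] z l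

/-- Every tensor is a finite sum of simple tensors, so the minimum in `tensorRank` is attained. -/
theorem exists_isSumOfSimple (T : A ⊗[ℂ] B ⊗[ℂ] C) : ∃ r, IsSumOfSimple T r := by
  have add : ∀ S S' : A ⊗[ℂ] B ⊗[ℂ] C, (∃ r, IsSumOfSimple S r) → (∃ r, IsSumOfSimple S' r) →
      ∃ r, IsSumOfSimple (S + S') r := by
    rintro S S' ⟨r, x, y, z, h⟩ ⟨r', x', y', z', h'⟩
    refine ⟨r + r', Fin.append x x', Fin.append y y', Fin.append z z', ?_⟩
    simp [Fin.sum_univ_add, h, h']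
  induction T using TensorProduct.induction_on with
  | zero => exact ⟨0, 0, 0, 0, by simp⟩
  | tmul u c =>
    induction u using TensorProduct.induction_on with
    | zero => exact ⟨0, 0, 0, 0, by simp⟩
    | tmul a b => exact ⟨1, fun _ => a, fun _ => b, fun _ => c, by simp⟩
    | add u v hu hv => rw [TensorProduct.add_tmul]; exact add _ _ hu hv
  | add S S' hS hS' => exact add _ _ hS hS'

/-- The tensor rank: the least number of simple tensors summing to `T`. -/
noncomputable def tensorRank (T : A ⊗[ℂ] B ⊗[ℂ] C) : ℕ :=
  sInf {r | IsSumOfSimple T r}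

/-- `T` is the limit of a sequence of tensors of rank at most `r`. The limit is taken in the
module topology over `ℂ`, which on a finite-dimensional space is the Euclidean topology. -/
def IsLimitOfRankLE (T : A ⊗[ℂ] B ⊗[ℂ] C) (r : ℕ) : Prop :=
  ∃ t : ℕ → A ⊗[ℂ] B ⊗[ℂ] C, (∀ m, tensorRank (t m) ≤ r) ∧
    Filter.Tendsto t Filter.atTop (@nhds _ (moduleTopology ℂ (A ⊗[ℂ] B ⊗[ℂ] C)) T)

/-- The constant sequence shows that the minimum in `borderRank` is attained. -/
theorem isLimitOfRankLE_tensorRank (T : A ⊗[ℂ] B ⊗[ℂ] C) : IsLimitOfRankLE T (tensorRank T) :=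
  ⟨fun _ => T, fun _ => le_rfl, by
    letI := moduleTopology ℂ (A ⊗[ℂ] B ⊗[ℂ] C)
    exact tendsto_const_nhds⟩

/-- The border rank: the least `r` such that `T` is a limit of tensors of rank at most `r`. -/
noncomputable def borderRank (T : A ⊗[ℂ] B ⊗[ℂ] C) : ℕ :=
  sInf {r | IsLimitOfRankLE T r}

/-- The Kronecker product of two tensors of order three: the tensor product `T ⊗ S` with the
factors regrouped, regarded again as a tensor of order three. It is determined by bilinearity
and its value on simple tensors, see `kronecker_tmul`. -/
noncomputable def kronecker (T : A ⊗[ℂ] B ⊗[ℂ] C) (S : A' ⊗[ℂ] B' ⊗[ℂ] C') :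
    (A ⊗[ℂ] A') ⊗[ℂ] (B ⊗[ℂ] B') ⊗[ℂ] (C ⊗[ℂ] C') :=
  (TensorProduct.tensorTensorTensorComm ℂ A B A' B').toLinearMap.rTensor (C ⊗[ℂ] C')
    (TensorProduct.tensorTensorTensorComm ℂ (A ⊗[ℂ] B) C (A' ⊗[ℂ] B') C' (T ⊗ₜ[ℂ] S))

theorem kronecker_tmul (a : A) (b : B) (c : C) (a' : A') (b' : B') (c' : C') :
    kronecker (a ⊗ₜ[ℂ] b ⊗ₜ[ℂ] c) (a' ⊗ₜ[ℂ] b' ⊗ₜ[ℂ] c') =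
      (a ⊗ₜ[ℂ] a') ⊗ₜ[ℂ] (b ⊗ₜ[ℂ] b') ⊗ₜ[ℂ] (c ⊗ₜ[ℂ] c') := by
  simp [kronecker]

end General

/-- The standard basis vector `e i` of `ℂ^(q+1)`, for `i = 0, …, q`. -/
def e {q : ℕ} (i : Fin (q + 1)) : Fin (q + 1) → ℂ := Pi.single i 1

/-- The little Coppersmith–Winograd tensor; `j : Fin q` stands for the index `j + 1`, so
`e j.succ` runs through `e 1, …, e q`. -/
noncomputable def littleCW (q : ℕ) :
    (Fin (q + 1) → ℂ) ⊗[ℂ] (Fin (q + 1) → ℂ) ⊗[ℂ] (Fin (q + 1) → ℂ) :=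
  ∑ j : Fin q,
    (e 0 ⊗ₜ[ℂ] e j.succ ⊗ₜ[ℂ] e j.succ + e j.succ ⊗ₜ[ℂ] e 0 ⊗ₜ[ℂ] e j.succ +
      e j.succ ⊗ₜ[ℂ] e j.succ ⊗ₜ[ℂ] e 0)

end BorderRank

/-!
Upper bound: expanding the cubes of `e 0 + t • e j`, of `e 0 + t² • ∑ j, e j` and of `e 0` in
powers of `t` gives a combination of `q + 2` cubes that tends to `T_{cw,q}` as `t → 0`; border rank
is submultiplicative under `⊠`.

Lower bound: project `A ⊗ A'` to `ℂ⁵` by `e a ⊗ e a' ↦ e (a - a' mod 5)` for `a, a' < 4`, and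
all other basis vectors to zero. For each `x` in `ℂ⁵` the map `x ∧ · : ⋀² ℂ⁵ → ⋀³ ℂ⁵` has rank
at most `6`, so the Koszul flattening `⋀² ℂ⁵ ⊗ (B ⊗ B')* → ⋀³ ℂ⁵ ⊗ (C ⊗ C')` has rank at most
`6` times the border rank. With the coordinates of `ℂ^(q+1)` split into the group `0, 1, 2, 3`
and `q - 3` single ones, the flattening is block diagonal. Modulo `2` the blocks have ranks
`6 * 25`, `6 * 5`, `6 * 5` and `6` for a pair of groups of which none, the first, the second or
both are single, in total `6 * (q + 2)²`.
-/

namespace BorderRank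

theorem tendsto_bilinear {V W X : Type*} [AddCommGroup V] [Module ℂ V] [Module.Finite ℂ V]
    [AddCommGroup W] [Module ℂ W] [AddCommGroup X] [Module ℂ X] (f : V →ₗ[ℂ] W →ₗ[ℂ] X)
    {ι : Type*} {l : Filter ι} {v : ι → V} {w : ι → W} {v₀ : V} {w₀ : W}
    (hv : Filter.Tendsto v l (@nhds _ (moduleTopology ℂ V) v₀))
    (hw : Filter.Tendsto w l (@nhds _ (moduleTopology ℂ W) w₀)) :
    Filter.Tendsto (fun i => f (v i) (w i)) l (@nhds _ (moduleTopology ℂ X) (f v₀ w₀)) := by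
  let _ : TopologicalSpace V := moduleTopology ℂ V
  let _ : TopologicalSpace W := moduleTopology ℂ W
  let _ : TopologicalSpace X := moduleTopology ℂ X
  have : IsModuleTopology ℂ V := ⟨rfl⟩
  have : IsModuleTopology ℂ W := ⟨rfl⟩
  have : IsModuleTopology ℂ X := ⟨rfl⟩
  exact ((IsModuleTopology.continuous_bilinear_of_finite_left f).tendsto (v₀, w₀)).comp
    (hv.prodMk_nhds hw)

section Kronecker

variable {A B C A' B' C' : Type*}
  [AddCommGroup A] [Module ℂ A] [AddCommGroup B] [Module ℂ B] [AddCommGroup C] [Module ℂ C]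
  [AddCommGroup A'] [Module ℂ A'] [AddCommGroup B'] [Module ℂ B'] [AddCommGroup C'] [Module ℂ C']

theorem isSumOfSimple_tensorRank (T : A ⊗[ℂ] B ⊗[ℂ] C) : IsSumOfSimple T (tensorRank T) :=
  Nat.sInf_mem (exists_isSumOfSimple T)

theorem isLimitOfRankLE_borderRank (T : A ⊗[ℂ] B ⊗[ℂ] C) : IsLimitOfRankLE T (borderRank T) :=
  Nat.sInf_mem (s := {r | IsLimitOfRankLE T r}) ⟨_, isLimitOfRankLE_tensorRank T⟩

theorem tensorRank_sum_tmul_le {ι : Type*} [Fintype ι] (x : ι → A) (y : ι → B) (z : ι → C) :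
    tensorRank (∑ i, x i ⊗ₜ[ℂ] y i ⊗ₜ[ℂ] z i) ≤ Fintype.card ι :=
  Nat.sInf_le ⟨x ∘ (Fintype.equivFin ι).symm, y ∘ (Fintype.equivFin ι).symm,
    z ∘ (Fintype.equivFin ι).symm, (Equiv.sum_comp (Fintype.equivFin ι).symm
      fun i => x i ⊗ₜ[ℂ] y i ⊗ₜ[ℂ] z i).symm⟩

/-- The Kronecker product as a bilinear map. -/
noncomputable def kroneckerBilin : (A ⊗[ℂ] B ⊗[ℂ] C) →ₗ[ℂ] (A' ⊗[ℂ] B' ⊗[ℂ] C') →ₗ[ℂ]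
    (A ⊗[ℂ] A') ⊗[ℂ] (B ⊗[ℂ] B') ⊗[ℂ] (C ⊗[ℂ] C') :=
  (TensorProduct.mk ℂ (A ⊗[ℂ] B ⊗[ℂ] C) (A' ⊗[ℂ] B' ⊗[ℂ] C')).compr₂
    ((TensorProduct.tensorTensorTensorComm ℂ A B A' B').toLinearMap.rTensor (C ⊗[ℂ] C') ∘ₗ
      (TensorProduct.tensorTensorTensorComm ℂ (A ⊗[ℂ] B) C (A' ⊗[ℂ] B') C').toLinearMap)

theorem kroneckerBilin_apply (T : A ⊗[ℂ] B ⊗[ℂ] C) (S : A' ⊗[ℂ] B' ⊗[ℂ] C') :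
    kroneckerBilin T S = kronecker T S := rfl

theorem tensorRank_kronecker_le (T : A ⊗[ℂ] B ⊗[ℂ] C) (S : A' ⊗[ℂ] B' ⊗[ℂ] C') :
    tensorRank (kronecker T S) ≤ tensorRank T * tensorRank S := by
  obtain ⟨x, y, z, hT⟩ := isSumOfSimple_tensorRank T
  obtain ⟨x', y', z', hS⟩ := isSumOfSimple_tensorRank S
  have hTS : kronecker T S = ∑ p : Fin (tensorRank T) × Fin (tensorRank S),
      (x p.1 ⊗ₜ[ℂ] x' p.2) ⊗ₜ[ℂ] (y p.1 ⊗ₜ[ℂ] y' p.2) ⊗ₜ[ℂ] (z p.1 ⊗ₜ[ℂ] z' p.2) := by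
    conv_lhs => rw [hT, hS, ← kroneckerBilin_apply]
    simp only [map_sum, LinearMap.sum_apply, Fintype.sum_prod_type_right, kroneckerBilin_apply,
      kronecker_tmul]
  rw [hTS]
  exact (tensorRank_sum_tmul_le _ _ _).trans_eq (by simp)

theorem borderRank_kronecker_le [Module.Finite ℂ A] [Module.Finite ℂ B] [Module.Finite ℂ C]
    (T : A ⊗[ℂ] B ⊗[ℂ] C) (S : A' ⊗[ℂ] B' ⊗[ℂ] C') :
    borderRank (kronecker T S) ≤ borderRank T * borderRank S := by
  obtain ⟨t, ht, htlim⟩ := isLimitOfRankLE_borderRank T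
  obtain ⟨s, hs, hslim⟩ := isLimitOfRankLE_borderRank S
  refine Nat.sInf_le ⟨fun m => kronecker (t m) (s m), fun m =>
    (tensorRank_kronecker_le _ _).trans (Nat.mul_le_mul (ht m) (hs m)), ?_⟩
  exact tendsto_bilinear (V := A ⊗[ℂ] B ⊗[ℂ] C) (W := A' ⊗[ℂ] B' ⊗[ℂ] C')
    (X := (A ⊗[ℂ] A') ⊗[ℂ] (B ⊗[ℂ] B') ⊗[ℂ] (C ⊗[ℂ] C')) kroneckerBilin htlim hslim

end Kronecker

section Polar

variable {V : Type*} [AddCommGroup V] [Module ℂ V]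

/-- The cube `v ⊗ v ⊗ v`. -/
def cube (v : V) : V ⊗[ℂ] V ⊗[ℂ] V := v ⊗ₜ[ℂ] v ⊗ₜ[ℂ] v

/-- The polarization of `cube` that is quadratic in `u` and linear in `v`. -/
def polar (u v : V) : V ⊗[ℂ] V ⊗[ℂ] V :=
  u ⊗ₜ[ℂ] u ⊗ₜ[ℂ] v + u ⊗ₜ[ℂ] v ⊗ₜ[ℂ] u + v ⊗ₜ[ℂ] u ⊗ₜ[ℂ] u

theorem cube_add_smul (u v : V) (s : ℂ) :
    cube (u + s • v) = cube u + s • polar u v + s ^ 2 • polar v u + s ^ 3 • cube v := by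
  simp only [cube, polar, TensorProduct.add_tmul, TensorProduct.tmul_add,
    ← TensorProduct.smul_tmul', TensorProduct.tmul_smul]
  module

theorem polar_sum_right {ι : Type*} [Fintype ι] (u : V) (v : ι → V) :
    polar u (∑ j, v j) = ∑ j, polar u (v j) := by
  simp only [polar, TensorProduct.tmul_sum, TensorProduct.sum_tmul, Finset.sum_add_distrib]

theorem tensorRank_sum_smul_cube_le {ι : Type*} [Fintype ι] (a : ι → ℂ) (v : ι → V) :
    tensorRank (∑ i, a i • cube (v i)) ≤ Fintype.card ι :=
  tensorRank_sum_tmul_le (fun i => a i • v i) v v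

variable {ι : Type*} [Fintype ι]

theorem sum_polar_approximation (u : V) (v : ι → V) {t : ℂ} (ht : t ≠ 0) :
    ∑ j, (t⁻¹ ^ 2) • cube (u + t • v j) - (t⁻¹ ^ 3) • cube (u + t ^ 2 • ∑ j, v j) +
        (t⁻¹ ^ 3 - Fintype.card ι * t⁻¹ ^ 2) • cube u =
      ∑ j, polar (v j) u + t • (∑ j, cube (v j) - polar (∑ j, v j) u) -
        t ^ 3 • cube (∑ j, v j) := by
  simp only [cube_add_smul, polar_sum_right, smul_add, Finset.sum_add_distrib, ← Finset.smul_sum,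
    Finset.sum_const, Finset.card_univ, ← Nat.cast_smul_eq_nsmul ℂ]
  match_scalars <;> field_simp <;> ring

theorem tensorRank_cube_combination_le (a b c : ℂ) (u w : V) (v : ι → V) :
    tensorRank (∑ j, a • cube (v j) - b • cube w + c • cube u) ≤ Fintype.card ι + 2 := by
  convert tensorRank_sum_smul_cube_le
    (fun i : Option (Option ι) => i.elim c (·.elim (-b) fun _ => a))
    (fun i => i.elim u (·.elim w v)) using 1
  · simp only [Fintype.sum_option, Option.elim]
    congr 1
    module
  · simp

theorem borderRank_sum_polar_le (u : V) (v : ι → V) :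
    borderRank (∑ j, polar (v j) u) ≤ Fintype.card ι + 2 := by
  let _ : TopologicalSpace (V ⊗[ℂ] V ⊗[ℂ] V) := moduleTopology ℂ _
  have : IsModuleTopology ℂ (V ⊗[ℂ] V ⊗[ℂ] V) := ⟨rfl⟩
  have := IsModuleTopology.topologicalAddGroup ℂ (V ⊗[ℂ] V ⊗[ℂ] V)
  let R := ∑ j, cube (v j) - polar (∑ j, v j) u
  let S := cube (∑ j, v j)
  let t (m : ℕ) : ℂ := 1 / ((m : ℂ) + 1)
  have ht (m : ℕ) : t m ≠ 0 := one_div_ne_zero (Nat.cast_add_one_ne_zero m)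
  refine Nat.sInf_le ⟨fun m => ∑ j, polar (v j) u + t m • R - t m ^ 3 • S, fun m => ?_, ?_⟩
  · exact (congrArg tensorRank (sum_polar_approximation u v (ht m))).symm.trans_le
      (tensorRank_cube_combination_le _ _ _ _ _ _)
  · have hcont : Continuous fun z : ℂ => ∑ j, polar (v j) u + z • R - z ^ 3 • S := by fun_prop
    have hlim := (hcont.tendsto 0).comp (tendsto_one_div_add_atTop_nhds_zero_nat (𝕜 := ℂ))
    simpa [Function.comp_def, t] using hlim

theorem littleCW_eq_sum_polar (q : ℕ) : littleCW q = ∑ j : Fin q, polar (e j.succ) (e 0) := by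
  refine Finset.sum_congr rfl fun j _ => ?_
  rw [polar]
  abel

theorem borderRank_littleCW_le (q : ℕ) : borderRank (littleCW q) ≤ q + 2 := by
  rw [littleCW_eq_sum_polar]
  exact (borderRank_sum_polar_le _ _).trans_eq (by rw [Fintype.card_fin])

end Polar

section MatrixRank

open scoped Matrix

variable {m n : Type*}

theorem matrix_rank_add_le {K : Type*} [Field K] [Finite m] [Fintype n] (A B : Matrix m n K) :
    (A + B).rank ≤ A.rank + B.rank := by
  have hle : LinearMap.range (A + B).mulVecLin ≤
      LinearMap.range A.mulVecLin ⊔ LinearMap.range B.mulVecLin := by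
    rw [Matrix.mulVecLin_add]
    rintro _ ⟨x, rfl⟩
    exact Submodule.add_mem_sup ⟨x, rfl⟩ ⟨x, rfl⟩
  exact (Submodule.finrank_mono hle).trans (Submodule.finrank_add_le_finrank_add_finrank _ _)

theorem matrix_rank_sum_le {K ι : Type*} [Field K] [Finite m] [Fintype n] (s : Finset ι)
    (A : ι → Matrix m n K) : (∑ i ∈ s, A i).rank ≤ ∑ i ∈ s, (A i).rank :=
  Finset.le_sum_of_subadditive _ Matrix.rank_zero.le matrix_rank_add_le s A

theorem exists_linearIndependent_row_submatrix {K : Type*} [Field K] [Finite m] [Fintype n]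
    (A : Matrix m n K) {k : ℕ} (hk : A.rank = k) :
    ∃ r : Fin k → m, LinearIndependent K (A.submatrix r id).row := by
  rw [← hk, Matrix.rank_eq_finrank_span_row]
  obtain ⟨f, hf, -, hind⟩ := Submodule.exists_fun_fin_finrank_span_eq K (Set.range A.row)
  choose r hr using hf
  obtain rfl : A.row ∘ r = f := funext hr
  exact ⟨r, hind⟩

theorem exists_det_submatrix_ne_zero {K : Type*} [Field K] [Finite m] [Fintype n]
    (A : Matrix m n K) :
    ∃ (r : Fin A.rank → m) (c : Fin A.rank → n), (A.submatrix r c).det ≠ 0 := by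
  obtain ⟨r, hr⟩ := exists_linearIndependent_row_submatrix A rfl
  have hrank : (A.submatrix r id)ᵀ.rank = A.rank := by
    rw [Matrix.rank_transpose, hr.rank_matrix, Fintype.card_fin]
  obtain ⟨c, hc⟩ := exists_linearIndependent_row_submatrix _ hrank
  refine ⟨r, c, ?_⟩
  rw [← Matrix.det_transpose, ← isUnit_iff_ne_zero, ← Matrix.isUnit_iff_isUnit_det]
  exact Matrix.linearIndependent_rows_iff_isUnit.mp hc

theorem rank_map_le_rank_map {R K L : Type*} [CommRing R] [Field K] [Field L] [Finite m]
    [Fintype n] (f : R →+* K) {g : R →+* L} (hg : Function.Injective g) (A : Matrix m n R) :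
    (A.map f).rank ≤ (A.map g).rank := by
  obtain ⟨r, c, hdet⟩ := exists_det_submatrix_ne_zero (A.map f)
  have hdetR : (A.submatrix r c).det ≠ 0 := fun h => hdet <| by
    rw [Matrix.submatrix_map, ← RingHom.mapMatrix_apply, ← RingHom.map_det, h, map_zero]
  have hdetL : ((A.map g).submatrix r c).det ≠ 0 := by
    rw [Matrix.submatrix_map, ← RingHom.mapMatrix_apply, ← RingHom.map_det]
    exact (map_ne_zero_iff g hg).mpr hdetR
  calc (A.map f).rank = ((A.map g).submatrix r c).rank := by
        rw [Matrix.rank_of_det_ne_zero hdetL, Fintype.card_fin]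
    _ ≤ (A.map g).rank := Matrix.rank_submatrix_le _ r c

theorem sum_rank_le_rank_blockDiagonal {K o : Type*} [Field K] [Finite m] [Fintype n] [Fintype o]
    [DecidableEq o] (M : o → Matrix m n K) :
    ∑ i, (M i).rank ≤ (Matrix.blockDiagonal M).rank := by
  let L : ((i : o) → LinearMap.range (M i).mulVecLin) →ₗ[K] m × o → K :=
    LinearMap.pi fun a => LinearMap.proj a.1 ∘ₗ Submodule.subtype _ ∘ₗ LinearMap.proj a.2
  have hL : Function.Injective L := fun w w' h => by
    ext i a
    exact congrFun h (a, i)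
  have hrange : LinearMap.range L ≤ LinearMap.range (Matrix.blockDiagonal M).mulVecLin := by
    rintro _ ⟨w, rfl⟩
    choose v hv using fun i => (w i).2
    refine ⟨fun b => v b.2 b.1, ?_⟩
    ext ⟨a, i⟩
    simp only [Matrix.mulVecLin_apply, Matrix.mulVec, dotProduct, Matrix.blockDiagonal_apply,
      Fintype.sum_prod_type_right, ite_mul, zero_mul]
    simpa [L, Matrix.mulVec, dotProduct] using congrFun (hv i) a
  calc ∑ i, (M i).rank = Module.finrank K ((i : o) → LinearMap.range (M i).mulVecLin) :=
        (Module.finrank_pi_fintype K).symm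
    _ = Module.finrank K (LinearMap.range L) := (LinearMap.finrank_range_of_inj hL).symm
    _ ≤ (Matrix.blockDiagonal M).rank := Submodule.finrank_mono hrange

end MatrixRank

section Koszul

/-- The alternating map obtained from `f` by fixing the arguments outside `ι`. -/
def fixRight {R V M ι κ : Type*} [CommRing R] [AddCommGroup V] [Module R V] [AddCommGroup M]
    [Module R M] (f : V [⋀^ι ⊕ κ]→ₗ[R] M) (w : κ → V) : V [⋀^ι]→ₗ[R] M where
  toFun v := f (Sum.elim v w)
  map_update_add' v i a b := by
    classical simp only [Sum.elim_update_left, f.map_update_add]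
  map_update_smul' v i c a := by
    classical simp only [Sum.elim_update_left, f.map_update_smul]
  map_eq_zero_of_eq' v i j hv hij :=
    f.map_eq_zero_of_eq (Sum.elim v w) (i := .inl i) (j := .inl j) hv (Sum.inl_injective.ne hij)

theorem rank_alternatingMap_le {K V I J κ : Type*} [Field K] [AddCommGroup V] [Module K V]
    [FiniteDimensional K V] [Finite I] [Fintype J] {p : ℕ} (f : V [⋀^Fin p ⊕ κ]→ₗ[K] K)
    (v : I → Fin p → V) (w : J → κ → V) :
    (Matrix.of fun i j => f (Sum.elim (v i) (w j))).rank ≤ (Module.finrank K V).choose p := by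
  let b := Module.finBasis K (⋀[K]^p V)
  let g (j : J) : ⋀[K]^p V →ₗ[K] K := exteriorPower.alternatingMapLinearEquiv (fixRight f (w j))
  have hfactor : (Matrix.of fun i j => f (Sum.elim (v i) (w j))) =
      (Matrix.of fun i a => b.repr (exteriorPower.ιMulti K p (v i)) a) *
        Matrix.of fun a j => g j (b a) := by
    ext i j
    calc f (Sum.elim (v i) (w j)) = g j (exteriorPower.ιMulti K p (v i)) :=
          (exteriorPower.alternatingMapLinearEquiv_apply_ιMulti (fixRight f (w j)) (v i)).symm
      _ = ∑ a, b.repr (exteriorPower.ιMulti K p (v i)) a * g j (b a) := by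
          conv_lhs => rw [← b.sum_repr (exteriorPower.ιMulti K p (v i)), map_sum]
          simp only [map_smul, smul_eq_mul]
  calc _ ≤ Module.finrank K (⋀[K]^p V) := by
        rw [hfactor]
        exact (Matrix.rank_mul_le_left _ _).trans
          ((Matrix.rank_le_card_width _).trans_eq (Fintype.card_fin _))
    _ = (Module.finrank K V).choose p := exteriorPower.finrank_eq K p

variable {p r : ℕ}

/-- The determinant with rows `x`, `v 0`, …, `v (p - 1)`, `w 0`, …, `w (r - 1)`. -/
def splitDet (R : Type*) [CommRing R] (p r : ℕ) : (Fin (p + r + 1) → R) →ₗ[R]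
    (Fin (p + r + 1) → R) [⋀^Fin p ⊕ Fin r]→ₗ[R] R where
  toFun x := (Matrix.detRowAlternating.curryLeft x).domDomCongr finSumFinEquiv.symm
  map_add' x y := by rw [map_add]; rfl
  map_smul' c x := by rw [map_smul]; rfl

theorem splitDet_apply {R : Type*} [CommRing R] (x : Fin (p + r + 1) → R)
    (v : Fin p ⊕ Fin r → Fin (p + r + 1) → R) :
    splitDet R p r x v = (Matrix.of (Matrix.vecCons x (v ∘ finSumFinEquiv.symm))).det := rfl

theorem splitDet_sub_smul {R : Type*} [CommRing R] (x : Fin (p + r + 1) → R)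
    (v : Fin p ⊕ Fin r → Fin (p + r + 1) → R) (c : Fin p ⊕ Fin r → R) :
    splitDet R p r x (fun i => v i - c i • x) = splitDet R p r x v := by
  rw [splitDet_apply, splitDet_apply, eq_comm]
  refine Matrix.det_eq_of_forall_row_eq_smul_add_const
    (Matrix.vecCons 0 (c ∘ finSumFinEquiv.symm)) 0 rfl fun i j => ?_
  cases i using Fin.cases <;> simp

/-- The matrix of the Koszul map `⋀ᵖ Rⁿ → ⋀ᵖ⁺¹ Rⁿ`, `v ↦ x ∧ v`, for `n = p + r + 1`: here
`⋀ᵖ⁺¹ Rⁿ` is paired with `⋀ʳ Rⁿ` by the determinant, and all sequences of standard basis vectors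
are used instead of the increasing ones, which repeats rows and columns up to sign. -/
def koszul (R : Type*) [CommRing R] (p r : ℕ) : (Fin (p + r + 1) → R) →ₗ[R]
    Matrix (Fin p → Fin (p + r + 1)) (Fin r → Fin (p + r + 1)) R where
  toFun x := Matrix.of fun s t => splitDet R p r x fun i => Pi.single (Sum.elim s t i) 1
  map_add' x y := by ext; simp
  map_smul' c x := by ext; simp

theorem rank_koszul_le {K : Type*} [Field K] (x : Fin (p + r + 1) → K) :
    (koszul K p r x).rank ≤ (p + r).choose p := by
  obtain rfl | hx := eq_or_ne x 0
  · simp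
  obtain ⟨i, hi⟩ := Function.ne_iff.mp hx
  let φ : Module.Dual K (Fin (p + r + 1) → K) := (x i)⁻¹ • LinearMap.proj i
  have hφ : φ x = 1 := inv_mul_cancel₀ hi
  have hker (v : Fin (p + r + 1) → K) : v - φ v • x ∈ LinearMap.ker φ := by simp [hφ]
  have hdim : Module.finrank K (LinearMap.ker φ) = p + r := by
    have h := Module.Dual.finrank_ker_add_one_of_ne_zero (f := φ) fun h => by simp [h] at hφ
    simpa using h
  let P (v : Fin (p + r + 1) → K) : LinearMap.ker φ := ⟨v - φ v • x, hker v⟩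
  let f : (LinearMap.ker φ) [⋀^Fin p ⊕ Fin r]→ₗ[K] K := (splitDet K p r x).compLinearMap
    (Submodule.subtype _)
  have hP : koszul K p r x = Matrix.of fun s t =>
      f (Sum.elim (fun i => P (Pi.single (s i) 1)) fun j => P (Pi.single (t j) 1)) := by
    ext s t
    refine (splitDet_sub_smul x _ fun i => φ (Pi.single (Sum.elim s t i) 1)).symm.trans
      (congrArg (splitDet K p r x) ?_)
    ext (_ | _) <;> rfl
  calc (koszul K p r x).rank ≤ (Module.finrank K (LinearMap.ker φ)).choose p := by
        rw [hP]
        exact rank_alternatingMap_le f _ _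
    _ = (p + r).choose p := by rw [hdim]

theorem map_koszul_apply {R S : Type*} [CommRing R] [CommRing S] (f : R →+* S)
    (x : Fin (p + r + 1) → R) (s : Fin p → Fin (p + r + 1)) (t : Fin r → Fin (p + r + 1)) :
    f (koszul R p r x s t) = koszul S p r (f ∘ x) s t := by
  refine (RingHom.map_det f _).trans (congrArg Matrix.det ?_)
  ext i j
  cases i using Fin.cases with
  | zero => rfl
  | succ i =>
    refine (Pi.apply_single (fun _ => f) (fun _ => map_zero f) _ _ _).trans ?_
    rw [map_one]
    rfl

theorem koszul_single_of_charTwo {R : Type*} [CommRing R] [CharP R 2] (c : Fin (p + r + 1))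
    (s : Fin p → Fin (p + r + 1)) (t : Fin r → Fin (p + r + 1)) :
    koszul R p r (Pi.single c 1) s t =
      if Function.Injective
        (Matrix.vecCons c (Sum.elim s t ∘ finSumFinEquiv.symm) : Fin (p + r + 1) → _)
      then 1 else 0 := by
  set σ : Fin (p + r + 1) → Fin (p + r + 1) :=
    Matrix.vecCons c (Sum.elim s t ∘ finSumFinEquiv.symm)
  have hdet : koszul R p r (Pi.single c 1) s t = ((1 : Matrix _ _ R).submatrix σ id).det := by
    refine congrArg Matrix.det ?_
    ext i j
    cases i using Fin.cases <;> exact Matrix.one_eq_pi_single.symm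
  rw [hdet]
  split_ifs with hinj
  · have h := Matrix.det_permute (Equiv.ofBijective σ hinj.bijective_of_finite) (1 : Matrix _ _ R)
    rw [Matrix.det_one, mul_one] at h
    refine h.trans ?_
    obtain h | h := Int.units_eq_one_or (Equiv.Perm.sign
      (Equiv.ofBijective σ hinj.bijective_of_finite)) <;> simp [h, CharTwo.neg_eq]
  · obtain ⟨i, j, hij, hne⟩ := Function.not_injective_iff.mp hinj
    exact Matrix.det_zero_of_row_eq hne (congrArg (1 : Matrix _ _ R) hij)

-- At a closed size the unifier would expand the determinant into a sum over permutations.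
attribute [irreducible] koszul

end Koszul

section Flattening

variable {A B C A' B' C' : Type*}
  [AddCommGroup A] [Module ℂ A] [AddCommGroup B] [Module ℂ B] [AddCommGroup C] [Module ℂ C]
  [AddCommGroup A'] [Module ℂ A'] [AddCommGroup B'] [Module ℂ B'] [AddCommGroup C'] [Module ℂ C']

/-- The slice of a tensor obtained by contracting its last two factors with two functionals. -/
noncomputable def slice (β : Module.Dual ℂ B) (γ : Module.Dual ℂ C) : A ⊗[ℂ] B ⊗[ℂ] C →ₗ[ℂ] A :=
  (TensorProduct.rid ℂ A).toLinearMap ∘ₗ β.lTensor A ∘ₗ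
    (TensorProduct.rid ℂ (A ⊗[ℂ] B)).toLinearMap ∘ₗ γ.lTensor (A ⊗[ℂ] B)

theorem slice_tmul (β : Module.Dual ℂ B) (γ : Module.Dual ℂ C) (a : A) (b : B) (c : C) :
    slice β γ (a ⊗ₜ[ℂ] b ⊗ₜ[ℂ] c) = (β b * γ c) • a := by
  simp [slice, smul_smul, mul_comm]

theorem slice_kronecker (β : Module.Dual ℂ B) (γ : Module.Dual ℂ C) (β' : Module.Dual ℂ B')
    (γ' : Module.Dual ℂ C') (T : A ⊗[ℂ] B ⊗[ℂ] C) (S : A' ⊗[ℂ] B' ⊗[ℂ] C') :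
    slice (TensorProduct.dualDistrib ℂ B B' (β ⊗ₜ β'))
        (TensorProduct.dualDistrib ℂ C C' (γ ⊗ₜ γ')) (kronecker T S) =
      slice β γ T ⊗ₜ slice β' γ' S := by
  obtain ⟨_, x, y, z, rfl⟩ := exists_isSumOfSimple T
  obtain ⟨_, x', y', z', rfl⟩ := exists_isSumOfSimple S
  rw [← kroneckerBilin_apply]
  simp only [map_sum, LinearMap.sum_apply, kroneckerBilin_apply, kronecker_tmul, slice_tmul,
    TensorProduct.dualDistrib_apply, TensorProduct.sum_tmul, TensorProduct.tmul_sum,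
    TensorProduct.smul_tmul_smul, mul_mul_mul_comm]

variable {I I' J L : Type*}

/-- The block matrix whose blocks are the images of the slices of a tensor under a linear map `F`
into matrices. For `F a` the Koszul map `v ↦ a ∧ v` and coordinate functionals `β`, `γ` this is the
Koszul flattening. -/
noncomputable def flattening (F : A →ₗ[ℂ] Matrix I I' ℂ) (β : J → Module.Dual ℂ B)
    (γ : L → Module.Dual ℂ C) (T : A ⊗[ℂ] B ⊗[ℂ] C) : Matrix (I × J) (I' × L) ℂ :=
  Matrix.of fun i j => F (slice (β i.2) (γ j.2) T) i.1 j.1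

theorem flattening_sum {ι : Type*} (F : A →ₗ[ℂ] Matrix I I' ℂ) (β : J → Module.Dual ℂ B)
    (γ : L → Module.Dual ℂ C) (s : Finset ι) (T : ι → A ⊗[ℂ] B ⊗[ℂ] C) :
    flattening F β γ (∑ l ∈ s, T l) = ∑ l ∈ s, flattening F β γ (T l) := by
  ext i j
  simp [flattening, Matrix.sum_apply]

variable [Finite I] [Fintype I'] [Finite J] [Fintype L]

theorem rank_flattening_tmul_le (F : A →ₗ[ℂ] Matrix I I' ℂ) (β : J → Module.Dual ℂ B)
    (γ : L → Module.Dual ℂ C) (a : A) (b : B) (c : C) :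
    (flattening F β γ (a ⊗ₜ[ℂ] b ⊗ₜ[ℂ] c)).rank ≤ (F a).rank := by
  classical
  have := Fintype.ofFinite I
  have := Fintype.ofFinite J
  let D := Matrix.diagonal fun i : I × J => β i.2 b
  let D' := Matrix.diagonal fun j : I' × L => γ j.2 c
  let N : Matrix (I × J) (I' × L) ℂ := (F a).submatrix Prod.fst Prod.fst
  have hfactor : flattening F β γ (a ⊗ₜ[ℂ] b ⊗ₜ[ℂ] c) = D * N * D' := by
    ext i j
    rw [Matrix.mul_diagonal, Matrix.diagonal_mul, flattening, Matrix.of_apply, slice_tmul,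
      map_smul, Matrix.smul_apply, smul_eq_mul]
    exact mul_right_comm _ _ _
  rw [hfactor]
  exact (Matrix.rank_mul_le_left _ _).trans ((Matrix.rank_mul_le_right _ _).trans
    (Matrix.rank_submatrix_le _ _ _))

theorem rank_flattening_le_tensorRank {F : A →ₗ[ℂ] Matrix I I' ℂ} {k : ℕ}
    (hF : ∀ a, (F a).rank ≤ k) (β : J → Module.Dual ℂ B) (γ : L → Module.Dual ℂ C)
    (T : A ⊗[ℂ] B ⊗[ℂ] C) : (flattening F β γ T).rank ≤ k * tensorRank T := by
  obtain ⟨x, y, z, hT⟩ := isSumOfSimple_tensorRank T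
  calc (flattening F β γ T).rank
      = (∑ l, flattening F β γ (x l ⊗ₜ[ℂ] y l ⊗ₜ[ℂ] z l)).rank := by
        conv_lhs => rw [hT, flattening_sum]
    _ ≤ ∑ l, (flattening F β γ (x l ⊗ₜ[ℂ] y l ⊗ₜ[ℂ] z l)).rank := matrix_rank_sum_le _ _
    _ ≤ ∑ _ : Fin (tensorRank T), k :=
        Finset.sum_le_sum fun l _ => (rank_flattening_tmul_le F β γ _ _ _).trans (hF _)
    _ = k * tensorRank T := by simp [mul_comm]

theorem rank_flattening_le_borderRank {F : A →ₗ[ℂ] Matrix I I' ℂ} {k : ℕ}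
    (hF : ∀ a, (F a).rank ≤ k) (β : J → Module.Dual ℂ B) (γ : L → Module.Dual ℂ C)
    (T : A ⊗[ℂ] B ⊗[ℂ] C) : (flattening F β γ T).rank ≤ k * borderRank T := by
  obtain ⟨t, ht, hlim⟩ := isLimitOfRankLE_borderRank T
  obtain ⟨r, c, hdet⟩ := exists_det_submatrix_ne_zero (flattening F β γ T)
  let _ : TopologicalSpace (A ⊗[ℂ] B ⊗[ℂ] C) := moduleTopology ℂ _
  have : IsModuleTopology ℂ (A ⊗[ℂ] B ⊗[ℂ] C) := ⟨rfl⟩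
  have hcont : Continuous fun U => ((flattening F β γ U).submatrix r c).det :=
    Continuous.matrix_det <| continuous_matrix fun i j =>
      IsModuleTopology.continuous_of_linearMap (Matrix.entryLinearMap ℂ ℂ (r i).1 (c j).1 ∘ₗ F ∘ₗ
        slice (β (r i).2) (γ (c j).2))
  obtain ⟨m, hm⟩ := (((hcont.tendsto T).comp hlim).eventually_ne hdet).exists
  calc (flattening F β γ T).rank = ((flattening F β γ (t m)).submatrix r c).rank := by
        rw [Matrix.rank_of_det_ne_zero hm, Fintype.card_fin]
    _ ≤ (flattening F β γ (t m)).rank := Matrix.rank_submatrix_le _ r c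
    _ ≤ k * tensorRank (t m) := rank_flattening_le_tensorRank hF β γ (t m)
    _ ≤ k * borderRank T := Nat.mul_le_mul_left k (ht m)

end Flattening

section Elimination

/-- Number of pivots found by Gaussian elimination over `ZMod 2` in the last `k` binary digits of
the rows, where a row is encoded as the natural number with these digits. -/
def eliminationRank : ℕ → List ℕ → ℕ
  | 0, _ => 0
  | k + 1, rows =>
    match rows.filter (·.testBit k) with
    | [] => eliminationRank k rows
    | r :: rest => eliminationRank k (rest.map (r ^^^ ·) ++ rows.filter (!·.testBit k)) + 1

/-- The vector over `ZMod 2` encoded by the last `n` binary digits of a natural number. -/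
def digitVector (n r : ℕ) : Fin n → ZMod 2 := fun i => if r.testBit i then 1 else 0

theorem digitVector_xor (n r s : ℕ) :
    digitVector n (r ^^^ s) = digitVector n r + digitVector n s := by
  ext i
  cases hr : r.testBit i <;> cases hs : s.testBit i <;>
    simp [digitVector, hr, hs, CharTwo.add_self_eq_zero]

theorem eliminationRank_le_finrank_span {n k : ℕ} (hk : k ≤ n) (rows : List ℕ) :
    eliminationRank k rows ≤
      Module.finrank (ZMod 2) (Submodule.span (ZMod 2) (digitVector n '' {r | r ∈ rows})) := by
  induction k generalizing rows with
  | zero => exact Nat.zero_le _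
  | succ k ih =>
    rw [eliminationRank]
    split
    · exact ih (Nat.le_of_succ_le hk) rows
    · next r rest hfilter =>
      set U := Submodule.span (ZMod 2) (digitVector n '' {r | r ∈ rows})
      have hmem {s : ℕ} (hs : s ∈ rows) : digitVector n s ∈ U := Submodule.subset_span ⟨s, hs, rfl⟩
      have hpivot {s : ℕ} (hs : s ∈ r :: rest) : s ∈ rows ∧ s.testBit k = true := by
        rwa [← hfilter, List.mem_filter] at hs
      obtain ⟨hr, hrk⟩ := hpivot List.mem_cons_self
      refine (Nat.succ_le_succ (ih (Nat.le_of_succ_le hk) _)).trans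
        (Submodule.finrank_lt_finrank_of_lt (t := U) ?_)
      suffices Submodule.span (ZMod 2)
          (digitVector n '' {s | s ∈ rest.map (r ^^^ ·) ++ rows.filter (!·.testBit k)}) ≤
            U ⊓ LinearMap.ker (LinearMap.proj (⟨k, hk⟩ : Fin n)) from
        lt_of_le_of_ne (this.trans inf_le_left) fun h => by
          have hzero : digitVector n r ⟨k, hk⟩ = 0 := (this (h ▸ hmem hr)).2
          simp [digitVector, hrk] at hzero
      rw [Submodule.span_le]
      rintro _ ⟨s', hs', rfl⟩
      rcases List.mem_append.mp hs' with hs' | hs'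
      · obtain ⟨s, hs, rfl⟩ := List.mem_map.mp hs'
        obtain ⟨hs, hsk⟩ := hpivot (List.mem_cons_of_mem r hs)
        exact ⟨digitVector_xor n r s ▸ add_mem (hmem hr) (hmem hs), by simp [digitVector, hrk, hsk]⟩
      · obtain ⟨hs, hsk⟩ := List.mem_filter.mp hs'
        exact ⟨hmem hs, by simpa [digitVector] using hsk⟩

/-- The natural number with the given binary digits, the least significant one first. -/
def ofBits (l : List Bool) : ℕ := l.foldr Nat.bit 0

theorem testBit_ofBits (l : List Bool) (k : ℕ) : (ofBits l).testBit k = l.getD k false := by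
  induction l generalizing k with
  | nil => simp [ofBits]
  | cons b l ih =>
    cases k with
    | zero => exact Nat.testBit_bit_zero b _
    | succ k => exact (Nat.testBit_bit_succ k b _).trans (ih k)

theorem eliminationRank_le_rank {ι κ : Type*} [Fintype κ] (M : ι → κ → Bool) (rows : List ι)
    (cols : List κ) :
    eliminationRank cols.length (rows.map fun i => ofBits (cols.map (M i))) ≤
      (Matrix.of fun i j => if M i j then (1 : ZMod 2) else 0).rank := by
  refine (eliminationRank_le_finrank_span le_rfl _).trans (le_trans ?_
    (Matrix.rank_submatrix_le _ rows.get cols.get))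
  rw [Matrix.rank_eq_finrank_span_row]
  refine Submodule.finrank_mono (Submodule.span_mono ?_)
  rintro _ ⟨r, hr, rfl⟩
  obtain ⟨i, hi, rfl⟩ := List.mem_map.mp hr
  obtain ⟨l, rfl⟩ := List.get_of_mem hi
  exact ⟨l, by ext j; simp [digitVector, testBit_ofBits]⟩

end Elimination

section CoppersmithWinograd

/-- The index `a` for which `e a ⊗ e b ⊗ e c` occurs in the little Coppersmith–Winograd tensor, if
there is one. -/
def slot {q : ℕ} (b c : Fin (q + 1)) : Option (Fin (q + 1)) :=
  if b = 0 then (if c = 0 then none else some c) else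
    if c = 0 then some b else if b = c then some 0 else none

/-- The standard basis vector with the given index, or zero if there is no index. -/
def basisVector (R : Type*) [CommRing R] {n : ℕ} (c : Option (Fin n)) : Fin n → R :=
  c.elim 0 fun a => Pi.single a 1

theorem basisVector_apply (R : Type*) [CommRing R] {n : ℕ} (c : Option (Fin n)) (a : Fin n) :
    basisVector R c a = if c = some a then 1 else 0 := by
  cases c <;> simp [basisVector, Pi.single_apply, eq_comm]

theorem comp_basisVector {R S : Type*} [CommRing R] [CommRing S] (f : R →+* S) {n : ℕ}
    (c : Option (Fin n)) : f ∘ basisVector R c = basisVector S c := by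
  ext a
  simp [basisVector_apply, apply_ite f]

theorem slice_littleCW {q : ℕ} (b c : Fin (q + 1)) :
    slice (LinearMap.proj b) (LinearMap.proj c) (littleCW q) = basisVector ℂ (slot b c) := by
  simp only [littleCW, map_sum, map_add, slice_tmul, LinearMap.proj_apply]
  cases b using Fin.cases with
  | zero =>
    cases c using Fin.cases with
    | zero => simp [slot, basisVector, e]
    | succ c => simp [slot, basisVector, e, Pi.single_apply]
  | succ b =>
    cases c using Fin.cases with
    | zero => simp [slot, basisVector, e, Pi.single_apply]
    | succ c =>
      by_cases hbc : b = c <;> simp [slot, basisVector, e, Pi.single_apply, hbc]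

variable {w : ℕ}

/-- The coordinates of the tensor for `q = w + 3` are divided into a group of four, which belongs
to `none`, and `w` single ones, each of which is repeated four times. -/
def groupIndex (x : Option (Fin w)) (b : Fin 4) : Fin (w + 3 + 1) :=
  x.elim (b.castLE (Nat.le_add_left 4 w)) fun i => i.addNat 4

theorem groupIndex_eq_iff (x y : Option (Fin w)) (b c : Fin 4) :
    groupIndex x b = groupIndex y c ↔ x = y ∧ (x = none → b = c) := by
  cases x <;> cases y <;> simp [groupIndex, Fin.ext_iff] <;> omega

/-- The projection to the first four coordinates. -/
def firstFour (w : ℕ) : (Fin (w + 3 + 1) → ℂ) →ₗ[ℂ] (Fin 4 → ℂ) :=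
  LinearMap.funLeft ℂ ℂ (groupIndex none)

/-- The index `a < 4` for which `e a ⊗ e b ⊗ e c` occurs in the little Coppersmith–Winograd tensor,
where `b` and `c` are positions in the group of four coordinates, or in a single one. -/
def groupSlot (isSingle : Bool) (b c : Fin 4) : Option (Fin 4) :=
  if isSingle then some 0 else slot b c

theorem slot_groupIndex_eq_some_iff (x y : Option (Fin w)) (a b c : Fin 4) :
    slot (groupIndex x b) (groupIndex y c) = some (groupIndex none a) ↔
      x = y ∧ groupSlot x.isSome b c = some a := by
  have hzero : (0 : Fin (w + 3 + 1)) = groupIndex none 0 := rfl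
  cases x <;> cases y <;>
    simp only [slot, groupSlot, hzero, groupIndex_eq_iff, Option.isSome, reduceCtorEq] <;>
      split_ifs <;> simp_all [groupIndex_eq_iff]

theorem firstFour_slice_littleCW (x y : Option (Fin w)) (b c : Fin 4) :
    firstFour w (slice (LinearMap.proj (groupIndex x b)) (LinearMap.proj (groupIndex y c))
      (littleCW (w + 3))) =
      if x = y then basisVector ℂ (groupSlot x.isSome b c) else 0 := by
  ext a
  simp only [slice_littleCW, firstFour, LinearMap.funLeft_apply, basisVector_apply, ite_apply,
    slot_groupIndex_eq_some_iff, ite_and, Pi.zero_apply]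

/-- The difference of two indices modulo `5`. -/
def cyclicSub (a a' : Fin 4) : Fin (2 + 2 + 1) := a.castSucc - a'.castSucc

/-- The linear map `ℂ⁴ ⊗ ℂ⁴ → ℂ⁵` with `e a ⊗ e a' ↦ e (a - a')`, indices taken modulo `5`. -/
noncomputable def cyclicSubMap : (Fin 4 → ℂ) ⊗[ℂ] (Fin 4 → ℂ) →ₗ[ℂ] (Fin (2 + 2 + 1) → ℂ) :=
  ((Pi.basisFun ℂ (Fin 4)).tensorProduct (Pi.basisFun ℂ (Fin 4))).constr ℂ fun a =>
    Pi.single (cyclicSub a.1 a.2) 1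

theorem cyclicSubMap_single (a a' : Fin 4) :
    cyclicSubMap (Pi.single a 1 ⊗ₜ Pi.single a' 1) = Pi.single (cyclicSub a a') 1 := by
  have h := ((Pi.basisFun ℂ (Fin 4)).tensorProduct (Pi.basisFun ℂ (Fin 4))).constr_basis ℂ
    (fun a => (Pi.single (cyclicSub a.1 a.2) 1 : Fin (2 + 2 + 1) → ℂ)) (a, a')
  rwa [Module.Basis.tensorProduct_apply, Pi.basisFun_apply, Pi.basisFun_apply] at h

theorem cyclicSubMap_basisVector (c c' : Option (Fin 4)) :
    cyclicSubMap (basisVector ℂ c ⊗ₜ basisVector ℂ c') =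
      basisVector ℂ (Option.map₂ cyclicSub c c') := by
  cases c <;> cases c' <;> simp [basisVector, cyclicSubMap_single]

/-- Indices of rows and of columns of a block of the Koszul flattening: a pair of indices for
`⋀² ℂ⁵`, and a position in a pair of groups of coordinates. -/
abbrev BlockIndex : Type := (Fin 2 → Fin (2 + 2 + 1)) × Fin 4 × Fin 4

/-- The block of the Koszul flattening of the square of the little Coppersmith–Winograd tensor that
belongs to a pair of groups of coordinates. The flags tell which of the two are single ones. -/
def koszulBlock (R : Type*) [CommRing R] (x y : Bool) : Matrix BlockIndex BlockIndex R :=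
  Matrix.of fun i j => koszul R 2 2 (basisVector R
    (Option.map₂ cyclicSub (groupSlot x i.2.1 j.2.1) (groupSlot y i.2.2 j.2.2))) i.1 j.1

theorem map_koszulBlock {R S : Type*} [CommRing R] [CommRing S] (f : R →+* S) (x y : Bool) :
    (koszulBlock R x y).map f = koszulBlock S x y := by
  ext i j
  simp only [koszulBlock, Matrix.map_apply, Matrix.of_apply, map_koszul_apply, comp_basisVector]

/-- The coordinate functional on `B ⊗ B'` for given positions in a pair of groups. -/
noncomputable def squareFunctional (b : (Fin 4 × Fin 4) × Option (Fin w) × Option (Fin w)) :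
    Module.Dual ℂ ((Fin (w + 3 + 1) → ℂ) ⊗[ℂ] (Fin (w + 3 + 1) → ℂ)) :=
  TensorProduct.dualDistrib ℂ _ _
    (LinearMap.proj (groupIndex b.2.1 b.1.1) ⊗ₜ LinearMap.proj (groupIndex b.2.2 b.1.2))

/-- The Koszul flattening of the square of the little Coppersmith–Winograd tensor, with respect to
the projection of `A ⊗ A'` to `ℂ⁵` given by `cyclicSubMap`. -/
noncomputable def squareFlattening (w : ℕ) : Matrix
    ((Fin 2 → Fin (2 + 2 + 1)) × (Fin 4 × Fin 4) × Option (Fin w) × Option (Fin w))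
    ((Fin 2 → Fin (2 + 2 + 1)) × (Fin 4 × Fin 4) × Option (Fin w) × Option (Fin w)) ℂ :=
  flattening (koszul ℂ 2 2 ∘ₗ cyclicSubMap ∘ₗ TensorProduct.map (firstFour w) (firstFour w))
    squareFunctional squareFunctional (kronecker (littleCW (w + 3)) (littleCW (w + 3)))

theorem rank_squareFlattening_le (w : ℕ) : (squareFlattening w).rank ≤
    6 * borderRank (kronecker (littleCW (w + 3)) (littleCW (w + 3))) := by
  rw [squareFlattening]
  refine rank_flattening_le_borderRank (fun _ => ?_) _ _ _
  exact rank_koszul_le (p := 2) (r := 2) _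

theorem squareFlattening_submatrix (w : ℕ) :
    (squareFlattening w).submatrix (Equiv.prodAssoc _ _ _) (Equiv.prodAssoc _ _ _) =
      Matrix.blockDiagonal fun x : Option (Fin w) × Option (Fin w) =>
        koszulBlock ℂ x.1.isSome x.2.isSome := by
  ext ⟨⟨s, b, b'⟩, x, x'⟩ ⟨⟨t, c, c'⟩, y, y'⟩
  simp only [squareFlattening, flattening, squareFunctional, Matrix.submatrix_apply,
    Equiv.prodAssoc_apply, Matrix.of_apply, slice_kronecker, LinearMap.comp_apply,
    TensorProduct.map_tmul, firstFour_slice_littleCW, Matrix.blockDiagonal_apply, Prod.mk.injEq]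
  by_cases hx : x = y <;> by_cases hx' : x' = y' <;>
    simp [hx, hx', cyclicSubMap_basisVector, koszulBlock]

/-- One sixth of the rank of `koszulBlock` is the product of these numbers. -/
def blockRank (isSingle : Bool) : ℕ := if isSingle then 1 else 5

/-- Whether an entry of `koszulBlock (ZMod 2) x y` is nonzero. -/
def koszulBit (x y : Bool) (i j : BlockIndex) : Bool :=
  (Option.map₂ cyclicSub (groupSlot x i.2.1 j.2.1) (groupSlot y i.2.2 j.2.2)).any fun a =>
    [a, i.1 0, i.1 1, j.1 0, j.1 1].Nodup

theorem koszul_basisVector_zmod_two (c : Option (Fin (2 + 2 + 1)))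
    (s t : Fin 2 → Fin (2 + 2 + 1)) : koszul (ZMod 2) 2 2 (basisVector (ZMod 2) c) s t =
      if c.any fun a => [a, s 0, s 1, t 0, t 1].Nodup then 1 else 0 := by
  cases c with
  | none => simp [basisVector]
  | some a =>
    have hlist : [a, s 0, s 1, t 0, t 1] = List.ofFn
        (Matrix.vecCons a (Sum.elim s t ∘ finSumFinEquiv.symm) : Fin (2 + 2 + 1) → _) := rfl
    refine (koszul_single_of_charTwo (p := 2) (r := 2) a s t).trans ?_
    simp only [Option.any_some, hlist, decide_eq_true_eq, List.nodup_ofFn]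

theorem koszulBlock_zmod_two (x y : Bool) : koszulBlock (ZMod 2) x y =
    Matrix.of fun i j => if koszulBit x y i j then 1 else 0 := by
  ext i j
  exact koszul_basisVector_zmod_two _ _ _

/-- Indices of rows and columns of `koszulBlock`, one for each class of nonzero rows that agree
up to sign. -/
def blockIndices (x y : Bool) : List BlockIndex :=
  let positions (isSingle : Bool) : List (Fin 4) := if isSingle then [0] else [0, 1, 2, 3]
  [![0, 1], ![0, 2], ![0, 3], ![0, 4], ![1, 2], ![1, 3], ![1, 4], ![2, 3], ![2, 4], ![3, 4]] ×ˢ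
    (positions x ×ˢ positions y)

theorem blockRank_le_eliminationRank (x y : Bool) :
    6 * (blockRank x * blockRank y) ≤ eliminationRank (blockIndices x y).length
      ((blockIndices x y).map fun i => ofBits ((blockIndices x y).map (koszulBit x y i))) := by
  cases x <;> cases y <;> decide +kernel

theorem blockRank_le_rank_koszulBlock (x y : Bool) :
    6 * (blockRank x * blockRank y) ≤ (koszulBlock ℂ x y).rank :=
  calc 6 * (blockRank x * blockRank y) ≤ (koszulBlock (ZMod 2) x y).rank := by
        rw [koszulBlock_zmod_two]
        exact (blockRank_le_eliminationRank x y).trans (eliminationRank_le_rank _ _ _)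
    _ ≤ (koszulBlock ℂ x y).rank := by
        rw [← map_koszulBlock (Int.castRingHom (ZMod 2)), ← map_koszulBlock (Int.castRingHom ℂ)]
        exact rank_map_le_rank_map _ (RingHom.injective_int _) _

theorem le_borderRank_square_littleCW (w : ℕ) :
    (w + 5) ^ 2 ≤ borderRank (kronecker (littleCW (w + 3)) (littleCW (w + 3))) := by
  have hsum : ∑ x : Option (Fin w), blockRank x.isSome = w + 5 := by
    simp [Fintype.sum_option, blockRank, add_comm]
  refine Nat.le_of_mul_le_mul_left (c := 6) ?_ (by norm_num)
  calc 6 * (w + 5) ^ 2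
      = ∑ x : Option (Fin w) × Option (Fin w),
          6 * (blockRank x.1.isSome * blockRank x.2.isSome) := by
        rw [← hsum, sq, Finset.sum_mul_sum, Fintype.sum_prod_type, Finset.mul_sum]
        simp only [Finset.mul_sum]
    _ ≤ ∑ x : Option (Fin w) × Option (Fin w), (koszulBlock ℂ x.1.isSome x.2.isSome).rank :=
        Finset.sum_le_sum fun x _ => blockRank_le_rank_koszulBlock _ _
    _ ≤ ((squareFlattening w).submatrix _ _).rank := by
        rw [squareFlattening_submatrix]
        exact sum_rank_le_rank_blockDiagonal _
    _ ≤ (squareFlattening w).rank := Matrix.rank_submatrix_le _ _ _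
    _ ≤ _ := rank_squareFlattening_le w

end CoppersmithWinograd

end BorderRank

theorem theorem3p1 (q : ℕ) (hq : 3 ≤ q) :
    BorderRank.borderRank
      (BorderRank.kronecker (BorderRank.littleCW q) (BorderRank.littleCW q)) = (q + 2) ^ 2 := by
  apply le_antisymm
  · calc _ ≤ BorderRank.borderRank (BorderRank.littleCW q) *
            BorderRank.borderRank (BorderRank.littleCW q) :=
          BorderRank.borderRank_kronecker_le _ _
      _ ≤ (q + 2) ^ 2 := by
          rw [sq]
          exact Nat.mul_self_le_mul_self (BorderRank.borderRank_littleCW_le q)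
  · obtain ⟨w, rfl⟩ := Nat.exists_eq_add_of_le' hq
    exact BorderRank.le_borderRank_square_littleCW w
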